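/- Let $p$ and $l$ be prime numbers, and let $K$ be a finite extension of $\mathbf{Q}_p$ whose multiplicative group $K^\times$ has an element of order $l$. Let $\mathfrak{o}$ be the ring of integers of $K$, $\mathfrak{p}$ its maximal ideal, and $e$ the ramification index of $K|\mathbf{Q}_p$. Put $U_0=\mathfrak{o}^\times$ and $U_n=\operatorname{Ker}(\mathfrak{o}^\times\to(\mathfrak{o}/\mathfrak{p}^n)^\times)$ for $n>0$, and let $\bar U_n$ be the image of $U_n$ in the $\mathbf{F}_l$-space $K^\times/K^{\times l}$. Put $e_1=e/(p-1)$ if $l=p$, and $e_1=0$ if $l\neq p$. Then $e_1$ is an integer, $\bar U_{pe_1}$ is an $\mathbf{F}_l$-line (that is, $\dim_{\mathbf{F}_l}\bar U_{pe_1}=1$), and $\bar U_n$ is trivial for every $n>pe_1$. Moreover $\bar U_{pe_1}$ is the line which gives the unramified $(\mathbf{Z}/l\mathbf{Z})$-extension of $K$ upon adjoining $l$-th roots: in a given algebraic closure $\Omega$ of $K$, the field $K(\sqrt[l]{\bar U_{pe_1}})$, obtained by adjoining to $K$ all $l$-th roots of all elements of $K^\times$ whose class lies in $\bar U_{pe_1}$,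 is the one and only unramified Galois extension of $K$ with group isomorphic to $\mathbf{Z}/l\mathbf{Z}$; and, for an $\mathbf{F}_l$-line $D\subset K^\times/K^{\times l}$, the extension $K(\sqrt[l]{D})$ is an unramified $(\mathbf{Z}/l\mathbf{Z})$-extension of $K$ if and only if $D=\bar U_{pe_1}$. -/

import Mathlib

noncomputable section

namespace LocalKummer

section RingOfIntegers

variable (p : ℕ) [Fact p.Prime] (K : Type*) [Field K] [Algebra ℚ_[p] K] [Algebra ℤ_[p] K]
  [IsScalarTower ℤ_[p] ℚ_[p] K] [FiniteDimensional ℚ_[p] K]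

/-- The ring of integers `𝔬` of a finite extension `K` of `ℚ_p`: the integral closure of `ℤ_p`. -/
abbrev ringOfIntegers : Subalgebra ℤ_[p] K := integralClosure ℤ_[p] K

lemma mem_ringOfIntegers_iff (x : K) : x ∈ ringOfIntegers p K ↔ spectralNorm ℚ_[p] K x ≤ 1 := by
  have hx : IsIntegral ℚ_[p] x := Algebra.IsIntegral.isIntegral x
  rw [spectralNorm, spectralValue_le_one_iff (minpoly.monic hx), mem_integralClosure_iff]
  constructor
  · intro h n
    rw [minpoly.isIntegrallyClosed_eq_field_fractions' ℚ_[p] h, Polynomial.coeff_map]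
    exact PadicInt.norm_le_one _
  · intro h
    have hl : minpoly ℚ_[p] x ∈ Polynomial.lifts (algebraMap ℤ_[p] ℚ_[p]) := by
      rw [Polynomial.lifts_iff_coeff_lifts]
      exact fun n => ⟨⟨_, h n⟩, rfl⟩
    obtain ⟨q, hq, -, hm⟩ := Polynomial.lifts_and_natDegree_eq_and_monic hl (minpoly.monic hx)
    refine ⟨q, hm, ?_⟩
    rw [IsScalarTower.algebraMap_eq ℤ_[p] ℚ_[p] K, ← Polynomial.eval₂_map, hq]
    exact minpoly.aeval _ _

lemma isUnit_ringOfIntegers_iff (x : ringOfIntegers p K) :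
    IsUnit x ↔ spectralNorm ℚ_[p] K x = 1 := by
  have hmul : ∀ a b : K, spectralNorm ℚ_[p] K (a * b)
      = spectralNorm ℚ_[p] K a * spectralNorm ℚ_[p] K b := spectralAlgNorm_mul
  have hle := fun y : ringOfIntegers p K => (mem_ringOfIntegers_iff p K y).1 y.2
  constructor
  · intro h
    obtain ⟨y, hy⟩ := h.exists_right_inv
    have h1 : spectralNorm ℚ_[p] K x * spectralNorm ℚ_[p] K y = 1 := by
      rw [← hmul, ← spectralNorm_one (K := ℚ_[p]) (L := K)]
      exact congrArg _ (congrArg Subtype.val hy)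
    refine le_antisymm (hle x) ?_
    calc (1 : ℝ) = _ := h1.symm
      _ ≤ _ := mul_le_of_le_one_right (spectralNorm_nonneg _) (hle y)
  · intro h
    have hx0 : (x : K) ≠ 0 := by
      intro h0
      rw [h0, spectralNorm_zero] at h
      exact zero_ne_one h
    have hi : spectralNorm ℚ_[p] K (x : K)⁻¹ = 1 := by
      have h2 := hmul (x : K) (x : K)⁻¹
      rw [mul_inv_cancel₀ hx0, spectralNorm_one, h, one_mul] at h2
      exact h2.symm
    exact IsUnit.of_mul_eq_one ⟨(x : K)⁻¹, (mem_ringOfIntegers_iff p K _).2 hi.le⟩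
      (Subtype.ext (mul_inv_cancel₀ hx0))

instance : IsLocalRing (ringOfIntegers p K) := by
  refine IsLocalRing.of_nonunits_add fun a b ha hb => ?_
  have hle := fun y : ringOfIntegers p K => (mem_ringOfIntegers_iff p K y).1 y.2
  rw [mem_nonunits_iff, isUnit_ringOfIntegers_iff] at ha hb ⊢
  have h := isNonarchimedean_spectralNorm (K := ℚ_[p]) (L := K) (a : K) (b : K)
  exact (lt_of_le_of_lt h (max_lt (lt_of_le_of_ne (hle a) ha) (lt_of_le_of_ne (hle b) hb))).ne

/-- The maximal ideal `𝔭` of `𝔬`. -/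
abbrev maxIdeal : Ideal (ringOfIntegers p K) := IsLocalRing.maximalIdeal (ringOfIntegers p K)

/-- The (absolute) ramification index `e` of `K | ℚ_p`: the largest `n` with `p𝔬 ⊆ 𝔭 ^ n`. -/
def ramificationIndex : ℕ :=
  Ideal.ramificationIdx' (IsLocalRing.maximalIdeal ℤ_[p]) (maxIdeal p K)

/-- The unit filtration `U_n = ker (𝔬ˣ → (𝔬 / 𝔭 ^ n)ˣ)`, as a subgroup of `Kˣ`; `U_0 = 𝔬ˣ`. -/
def unitFiltration (n : ℕ) : Subgroup Kˣ :=
  (Units.map (Ideal.Quotient.mk (maxIdeal p K ^ n)).toMonoidHom).ker.map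
    (Units.map (ringOfIntegers p K).val.toRingHom.toMonoidHom)

end RingOfIntegers

section Kummer

variable (l : ℕ) (K : Type*) [Field K]

/-- The group `Kˣ / Kˣˡ`, written additively. -/
def PowerClasses : Type _ := Additive (Kˣ ⧸ (powMonoidHom l : Kˣ →* Kˣ).range)

instance : AddCommGroup (PowerClasses l K) :=
  inferInstanceAs (AddCommGroup (Additive (Kˣ ⧸ (powMonoidHom l : Kˣ →* Kˣ).range)))

variable {K} in
/-- The projection `Kˣ → Kˣ / Kˣˡ`. -/
def powerClass : Additive Kˣ →+ PowerClasses l K :=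
  MonoidHom.toAdditive (QuotientGroup.mk' (powMonoidHom l : Kˣ →* Kˣ).range)

/-- `Kˣ / Kˣˡ` is an `𝔽_l`-space. -/
instance : Module (ZMod l) (PowerClasses l K) :=
  AddCommGroup.zmodModule (n := l) fun x => by
    obtain ⟨z, rfl⟩ : ∃ z, powerClass l z = x :=
      QuotientGroup.mk'_surjective (powMonoidHom l : Kˣ →* Kˣ).range x
    rw [← map_nsmul]
    exact (QuotientGroup.eq_one_iff _).2 ⟨Additive.toMul z, rfl⟩

variable {K} in
/-- The image in `Kˣ / Kˣˡ` of a subgroup of `Kˣ`, as an `𝔽_l`-subspace. -/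
def imageInPowerClasses (H : Subgroup Kˣ) : Submodule (ZMod l) (PowerClasses l K) :=
  AddSubgroup.toZModSubmodule l (H.toAddSubgroup.map (powerClass l))

variable {K} in
/-- The extension `K(ˡ√D)` inside `Ω`, for a subspace `D` of `Kˣ / Kˣˡ`: adjoin to `K` all `l`-th
roots of all elements of `Kˣ` whose class lies in `D`. -/
def adjoinRoots (Ω : Type*) [Field Ω] [Algebra K Ω] (D : Submodule (ZMod l) (PowerClasses l K)) :
    IntermediateField K Ω :=
  IntermediateField.adjoin K
    {y : Ω | ∃ x : Kˣ, powerClass l (Additive.ofMul x) ∈ D ∧ y ^ l = algebraMap K Ω (x : K)}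

end Kummer

section Main

variable (p l : ℕ) [Fact p.Prime] (K : Type*) [Field K] [Algebra ℚ_[p] K] [Algebra ℤ_[p] K]
  [IsScalarTower ℤ_[p] ℚ_[p] K] [FiniteDimensional ℚ_[p] K]

/-- The induced filtration `Ū_n` on `Kˣ / Kˣˡ`. -/
def filtrationBar (n : ℕ) : Submodule (ZMod l) (PowerClasses l K) :=
  imageInPowerClasses l (unitFiltration p K n)

/-- `e₁ = e / (p - 1)` if `l = p` and `e₁ = 0` otherwise. -/
def e₁ : ℕ := if l = p then ramificationIndex p K / (p - 1) else 0

/-- `M | K` is an unramified `(ℤ/lℤ)`-extension: a finite Galois extension with group isomorphic to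
`ℤ/lℤ` such that the ring of integers of `M` is unramified over the ring of integers of `K`. -/
structure IsUnramifiedCyclicExtension (M : Type*) [Field M] [Algebra K M] : Prop where
  finiteDimensional : FiniteDimensional K M
  isGalois : IsGalois K M
  galoisGroup : Nonempty ((M ≃ₐ[K] M) ≃* Multiplicative (ZMod l))
  unramified : Algebra.Unramified (ringOfIntegers p K) (integralClosure (ringOfIntegers p K) M)

end Main

end LocalKummer

end

noncomputable section

open Polynomial IsLocalRing

/-! ### Finite free local algebras over a complete local ring are Henselian. -/

section Henselian

/-! Let `ζ` be a primitive `l`-th root of unity in `𝔬` and `t = ζ - 1`. Since `t ^ (l - 1)` is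
associated to `l`, the ideal `(t ^ l)` is `𝔭 ^ (p e₁)`, in the tame case (`l ≠ p`, both ideals
trivial) as in the wild one. So `U_{p e₁}` consists of the units `1 + t ^ l c`.

The substitution `y = 1 + t x` turns `y ^ l = 1 + t ^ l c` into `h(x) = c`, where `h = ((1 + t X) ^
l - 1) / t ^ l` is monic and integral, and `h'` is a unit times `(1 + t X) ^ (l - 1)`
(`IsPrimitiveRoot.exists_shiftedPower`). At a root of `h - c` the derivative is a unit as soon as `1
+ t ^ l c` is one. Everything follows from this separability.

If `c ∈ 𝔭`, the root `0` of `h - c` modulo `𝔭` lifts by Hensel, so deeper units are `l`-th powers.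
As `h(0) = h(1) = 0`, the reduction of `h` is not injective on the finite residue field, hence not
surjective, and some `c` gives a unit `a` that is not an `l`-th power
(`exists_isUnit_forall_pow_ne`). Roots of `h - c` generate unramified extensions
(`unramified_integralClosure_of_pow_eq`), and one of degree `l` is unique: residue fields of equal
degree are isomorphic, so a root passes from one to the other and lifts
(`exists_pow_eq_of_unramified`). Uniqueness also bounds the dimension: each nontrivial class in
`Ū_{p e₁}` has the same field of roots as `a`, so by Kummer theory
(`exists_eq_pow_mul_pow_of_mem_adjoin`) it lies on the line of `a`. The same Kummer argument shows
that no other line gives this field. -/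

theorem Module.Basis.mem_ideal_smul_top_iff {A M ι : Type*} [CommRing A] [AddCommGroup M]
    [Module A M] [Finite ι] (b : Module.Basis ι A M) (I : Ideal A) (x : M) :
    x ∈ (I • ⊤ : Submodule A M) ↔ ∀ i, b.repr x i ∈ I := by
  have := Fintype.ofFinite ι
  constructor
  · intro hx i
    refine Submodule.smul_induction_on hx (fun r hr m _ => ?_) (fun x y hx hy => ?_)
    · simpa using I.mul_mem_right _ hr
    · simpa using I.add_mem hx hy
  · intro h
    rw [← b.sum_repr x]
    exact Submodule.sum_mem _ fun i _ => Submodule.smul_mem_smul (h i) trivial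

/-- Congruences modulo `I ^ n` can be tested on coordinates in a basis, so limits exist and are
unique coordinate by coordinate. -/
theorem IsAdicComplete.of_finite_free {A M : Type*} [CommRing A] [AddCommGroup M] [Module A M]
    [Module.Finite A M] [Module.Free A M] (I : Ideal A) [IsAdicComplete I A] :
    IsAdicComplete I M := by
  cases subsingleton_or_nontrivial A
  · have := Module.subsingleton A M
    infer_instance
  let b := Module.Free.chooseBasis A M
  have key : ∀ (n : ℕ) (x y : M), x ≡ y [SMOD (I ^ n • ⊤ : Submodule A M)] ↔
      ∀ i, b.repr x i ≡ b.repr y i [SMOD (I ^ n • ⊤ : Ideal A)] := by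
    intro n x y
    simp only [SModEq.sub_mem, b.mem_ideal_smul_top_iff, smul_eq_mul, Ideal.mul_top, map_sub,
      Finsupp.coe_sub, Pi.sub_apply]
  refine { haus' := fun x hx => ?_, prec' := fun f hf => ?_ }
  · apply b.repr.injective
    ext i
    simp only [map_zero, Finsupp.coe_zero, Pi.zero_apply]
    refine IsHausdorff.haus' (I := I) _ fun n => ?_
    simpa using (key n x 0).1 (hx n) i
  · choose g hg using fun i => IsPrecomplete.prec' (I := I) (fun n => b.repr (f n) i)
      fun hmn => (key _ _ _).1 (hf hmn) i
    refine ⟨∑ i, g i • b i, fun n => (key _ _ _).2 fun i => ?_⟩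
    rw [b.repr_sum_self]
    exact hg i n

/-- Completeness gives Hensel's lemma only along `I`, the extension of the maximal ideal of `A`.
Since the maximal ideal of `S` is nil modulo `I`, an approximate root is first corrected in `S ⧸ I`
by Newton iteration with nilpotent error, then lifted along `I`. -/
theorem HenselianLocalRing.of_finite_free (A S : Type*) [CommRing A] [IsLocalRing A]
    [IsAdicComplete (maximalIdeal A) A] [CommRing S] [IsLocalRing S] [Algebra A S]
    [Module.Finite A S] [Module.Free A S] : HenselianLocalRing S := by
  let I : Ideal S := (maximalIdeal A).map (algebraMap A S)
  have : IsAdicComplete (maximalIdeal A) S := .of_finite_free _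
  have : IsAdicComplete I S := (IsAdicComplete.map_algebraMap_iff _ _).2 this
  have hI : I ≤ maximalIdeal S :=
    (IsAdicComplete.le_jacobson_bot I).trans (jacobson_eq_maximalIdeal ⊥ bot_ne_top).le
  have hnil : ∀ s ∈ maximalIdeal S, IsNilpotent (Ideal.Quotient.mk I s) := by
    intro s hs
    have hr : s ∈ I.radical := by
      rw [Ideal.radical_eq_sInf, Ideal.mem_sInf]
      rintro P ⟨hIP, hP⟩
      -- By integrality, a prime over the maximal ideal of `A` is maximal, so it is the maximal
      -- ideal of `S`.
      have hm : (P.comap (algebraMap A S)).IsMaximal := by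
        have h1 : maximalIdeal A ≤ P.comap (algebraMap A S) := Ideal.map_le_iff_le_comap.1 hIP
        rw [← (maximalIdeal.isMaximal A).eq_of_le (Ideal.IsPrime.comap _).ne_top h1]
        infer_instance
      have := Ideal.isMaximal_of_isIntegral_of_isMaximal_comap P hm
      rwa [eq_maximalIdeal this]
    obtain ⟨n, hn⟩ := hr
    exact ⟨n, by rw [← map_pow]; exact Ideal.Quotient.eq_zero_iff_mem.2 hn⟩
  refine { is_henselian := fun f hf a₀ h₁ h₂ => ?_ }
  have e1 : ∀ g : S[X], aeval (Ideal.Quotient.mk I a₀) g = Ideal.Quotient.mk I (g.eval a₀) :=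
    fun g => by
      rw [← Ideal.Quotient.algebraMap_eq, aeval_algebraMap_apply, coe_aeval_eq_eval]
  obtain ⟨r, ⟨hr1, hr2⟩, -⟩ := existsUnique_nilpotent_sub_and_aeval_eq_zero (P := f)
    (x := Ideal.Quotient.mk I a₀) (by rw [e1]; exact hnil _ h₁) (by rw [e1]; exact h₂.map _)
  obtain ⟨a₁, rfl⟩ := Ideal.Quotient.mk_surjective r
  have e2 : f.eval a₁ ∈ I := by
    rw [← Ideal.Quotient.algebraMap_eq, aeval_algebraMap_apply, coe_aeval_eq_eval] at hr2
    exact Ideal.Quotient.eq_zero_iff_mem.1 hr2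
  have e3 : a₁ - a₀ ∈ maximalIdeal S := by
    obtain ⟨n, hn⟩ := hr1
    rw [← map_sub, ← map_pow, Ideal.Quotient.eq_zero_iff_mem] at hn
    rw [← neg_sub]
    exact neg_mem ((maximalIdeal.isMaximal S).isPrime.mem_of_pow_mem _ (hI hn))
  have e4 : IsUnit (f.derivative.eval a₁) := by
    have h : f.derivative.eval a₁ - f.derivative.eval a₀ ∈ maximalIdeal S :=
      (maximalIdeal S).mem_of_dvd (sub_dvd_eval_sub _ _ _) e3
    by_contra hu
    have := (maximalIdeal S).sub_mem ((mem_maximalIdeal _).2 hu) h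
    rw [sub_sub_cancel] at this
    exact (mem_maximalIdeal _).1 this h₂
  obtain ⟨a, ha, hd⟩ := HenselianRing.is_henselian (I := I) f hf a₁ e2 (e4.map _)
  exact ⟨a, ha, by simpa using (maximalIdeal S).add_mem (hI hd) e3⟩

end Henselian

/-! ### The polynomial `((1 + t X) ^ l - 1) / t ^ l` for `t = ζ - 1`. -/

section ShiftedPower

variable {R : Type*} [CommRing R] [IsDomain R] {l : ℕ} [hl : Fact l.Prime] {ζ : R}

/-- `l` is the product of the `l - 1` factors `1 - ζ ^ k` with `0 < k < l`, each associated to `ζ -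
1`. -/
theorem IsPrimitiveRoot.associated_sub_one_pow_natCast (hζ : IsPrimitiveRoot ζ l) :
    Associated ((ζ - 1) ^ (l - 1)) (l : R) := by
  obtain ⟨n, hn⟩ : ∃ n, l = n + 1 := ⟨l - 1, (Nat.succ_pred hl.out.ne_zero).symm⟩
  have hζ' : IsPrimitiveRoot ζ (n + 1) := hn ▸ hζ
  have h1 : (l : R) = ∏ k ∈ Finset.range n, (1 - ζ ^ (k + 1)) := by
    rw [hζ'.prod_one_sub_pow_eq_order, hn]; push_cast; rfl
  have h2 : (ζ - 1) ^ (l - 1) = ∏ _k ∈ Finset.range n, (ζ - 1) := by simp [hn]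
  rw [h1, h2]
  refine Associated.prod _ _ _ fun k hk => ?_
  have hc : (k + 1).Coprime l := by
    refine Nat.Coprime.symm ((Nat.Prime.coprime_iff_not_dvd hl.out).2 fun h => ?_)
    have := Nat.le_of_dvd k.succ_pos h
    have := Finset.mem_range.1 hk
    omega
  have := hζ.associated_sub_one_pow_sub_one_of_coprime hc
  rw [← neg_sub 1 (ζ ^ (k + 1))] at this
  exact this.trans (Associated.neg_left (Associated.refl _))

/-- The polynomial `((1 + (ζ - 1) X) ^ l - 1) / (ζ - 1) ^ l` is monic and integral, and its
derivative is a unit times `(1 + (ζ - 1) X) ^ (l - 1)`. -/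
theorem IsPrimitiveRoot.exists_shiftedPower (hζ : IsPrimitiveRoot ζ l) :
    ∃ (η : Rˣ) (h : R[X]), C ((ζ - 1) ^ l) * h = (1 + C (ζ - 1) * X) ^ l - 1 ∧ h.Monic ∧
      h.natDegree = l ∧ derivative h = C (η : R) * (1 + C (ζ - 1) * X) ^ (l - 1) := by
  have hl1 := hl.out.one_lt
  set t : R := ζ - 1 with ht
  have ht0 : t ≠ 0 := sub_ne_zero.2 (hζ.ne_one hl1)
  obtain ⟨η, hη⟩ := hζ.associated_sub_one_pow_natCast
  rw [← ht] at hη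
  have htl : t * t ^ (l - 1) = t ^ l := by rw [← pow_succ', Nat.sub_add_cancel hl1.le]
  have hcoeff : ∀ i, ((1 + C t * X) ^ l : R[X]).coeff i = (l.choose i : R) * t ^ i := by
    intro i
    have : ((1 + C t * X) ^ l : R[X]) = ((1 + X) ^ l : R[X]).comp (C t * X) := by simp
    rw [this, comp_C_mul_X_coeff, coeff_one_add_X_pow]
  -- In degrees `0 < i < l` the binomial coefficient supplies `l`, hence `t ^ (l - 1)`, and `t ^ i`
  -- supplies the last factor `t`.
  have hdvd : C (t ^ l) ∣ ((1 + C t * X) ^ l - 1 : R[X]) := by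
    rw [C_dvd_iff_dvd_coeff]
    intro i
    rw [coeff_sub, hcoeff, coeff_one]
    rcases Nat.eq_zero_or_pos i with rfl | hi
    · simp
    rw [if_neg hi.ne', sub_zero]
    rcases lt_trichotomy i l with hil | rfl | hil
    · obtain ⟨a, ha⟩ := hl.out.dvd_choose_self hi.ne' hil
      obtain ⟨j, rfl⟩ : ∃ j, i = j + 1 := ⟨i - 1, by omega⟩
      refine ⟨η * a * t ^ j, ?_⟩
      rw [ha, Nat.cast_mul, ← hη, ← htl]
      ring
    · simp
    · simp [Nat.choose_eq_zero_of_lt hil]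
  obtain ⟨h, hh⟩ := hdvd
  have htl0 : t ^ l ≠ 0 := pow_ne_zero _ ht0
  have hC0 : (C (t ^ l) : R[X]) ≠ 0 := C_ne_zero.2 htl0
  have hc : ∀ i, 0 < i → t ^ l * h.coeff i = (l.choose i : R) * t ^ i := by
    intro i hi
    rw [← coeff_C_mul, ← hh, coeff_sub, hcoeff, coeff_one, if_neg hi.ne', sub_zero]
  have hcl : h.coeff l = 1 := by
    have := hc l hl.out.pos
    rw [Nat.choose_self, Nat.cast_one, one_mul] at this
    exact mul_left_cancel₀ htl0 (by rw [this, mul_one])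
  have hdeg : h.natDegree ≤ l := by
    rw [natDegree_le_iff_coeff_eq_zero]
    intro i hi
    have := hc i (by omega)
    rw [Nat.choose_eq_zero_of_lt hi, Nat.cast_zero, zero_mul] at this
    exact (mul_eq_zero.1 this).resolve_left htl0
  refine ⟨η, h, hh.symm, monic_of_natDegree_le_of_coeff_eq_one l hdeg hcl,
    le_antisymm hdeg (le_natDegree_of_ne_zero (by rw [hcl]; exact one_ne_zero)), ?_⟩
  apply mul_left_cancel₀ hC0
  have hd := congrArg derivative hh
  rw [derivative_C_mul] at hd
  rw [← hd]
  have e : (C (t ^ l) * C (η : R) : R[X]) = C (l : R) * C t := by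
    rw [← C_mul, ← C_mul, ← hη, ← htl]
    congr 1; ring
  rw [← mul_assoc, e]
  simp [derivative_pow]
  ring

end ShiftedPower

/-! ### The equation `y ^ l = 1 + t ^ l c` as `h(x) = c`, with `y = 1 + t x`. -/

section ShiftedPower

variable {R : Type*} [CommRing R] {l : ℕ} {t : R} {h : R[X]}

theorem one_add_mul_pow_eq_of_shiftedPower (hh : C (t ^ l) * h = (1 + C t * X) ^ l - 1)
    {S : Type*} [CommRing S] [Algebra R S] (x : S) :
    (1 + algebraMap R S t * x) ^ l = 1 + algebraMap R S t ^ l * aeval x h := by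
  have := congrArg (aeval x) hh
  simp only [map_mul, map_sub, map_pow, map_add, map_one, aeval_X, aeval_C] at this
  rw [this]; ring

theorem Polynomial.Monic.sub_C {h : R[X]} (hm : h.Monic) (hdeg : h.natDegree ≠ 0) (c : R) :
    (h - C c).Monic := by
  refine hm.sub_of_left (lt_of_le_of_lt degree_C_le ?_)
  exact natDegree_pos_iff_degree_pos.1 (Nat.pos_of_ne_zero hdeg)

theorem aeval_shiftedPower_of_pow_eq (hh : C (t ^ l) * h = (1 + C t * X) ^ l - 1)
    {L : Type*} [Field L] [Algebra R L] (ht : algebraMap R L t ≠ 0) {c : R} {y : L}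
    (hy : y ^ l = algebraMap R L (1 + t ^ l * c)) :
    aeval ((y - 1) / algebraMap R L t) (h - C c) = 0 := by
  have := one_add_mul_pow_eq_of_shiftedPower hh ((y - 1) / algebraMap R L t)
  rw [mul_div_cancel₀ _ ht, add_sub_cancel, hy] at this
  simp only [map_add, map_one, map_mul, map_pow, add_right_inj] at this
  rw [map_sub, aeval_C, sub_eq_zero]
  exact (mul_left_cancel₀ (pow_ne_zero _ ht) this).symm

/-- At an approximate root `x₀`, the `l`-th power of `1 + t x₀` is congruent to the unit `1 + t ^ l
c`. So the derivative of `h - c` is a unit there, and Hensel's lemma applies. -/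
theorem exists_pow_eq_of_aeval_shiftedPower_mem [NeZero l] [IsDomain R] {η : Rˣ}
    (hh : C (t ^ l) * h = (1 + C t * X) ^ l - 1) (hm : h.Monic) (hdeg : h.natDegree = l)
    (hd : derivative h = C (η : R) * (1 + C t * X) ^ (l - 1))
    {S : Type*} [CommRing S] [HenselianLocalRing S] [Algebra R S] {c : R}
    (hu : IsUnit (1 + t ^ l * c)) {x₀ : S} (hx : aeval x₀ (h - C c) ∈ maximalIdeal S) :
    ∃ y : S, y ^ l = algebraMap R S (1 + t ^ l * c) := by
  have hl : l ≠ 0 := NeZero.ne l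
  have hmc : (h - C c).Monic := hm.sub_C (hdeg ▸ hl) c
  have hu₀ : IsUnit (1 + algebraMap R S t * x₀) := by
    rw [← isUnit_pow_iff hl, one_add_mul_pow_eq_of_shiftedPower hh]
    by_contra hn
    have h2 := (maximalIdeal S).sub_mem ((mem_maximalIdeal _).2 hn)
      ((maximalIdeal S).mul_mem_left (algebraMap R S t ^ l) hx)
    rw [map_sub, aeval_C, mul_sub, add_sub_assoc, sub_sub_cancel] at h2
    have h3 := hu.map (algebraMap R S)
    simp only [map_add, map_one, map_mul, map_pow] at h3
    exact (mem_maximalIdeal _).1 h2 h3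
  obtain ⟨x, hx, -⟩ := HenselianLocalRing.is_henselian ((h - C c).map (algebraMap R S))
    (hmc.map _) x₀ (by rwa [eval_map_algebraMap]) (by
      rw [derivative_map, eval_map_algebraMap, derivative_sub, derivative_C, sub_zero, hd]
      simp only [map_mul, aeval_C, map_pow, map_add, map_one, aeval_X]
      exact (η.isUnit.map _).mul (hu₀.pow _))
  rw [IsRoot, eval_map_algebraMap, map_sub, aeval_C, sub_eq_zero] at hx
  exact ⟨_, by rw [one_add_mul_pow_eq_of_shiftedPower hh x, hx]; simp⟩

theorem eval_zero_shiftedPower [IsDomain R] (ht : t ≠ 0)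
    (hh : C (t ^ l) * h = (1 + C t * X) ^ l - 1) : h.eval 0 = 0 := by
  have := one_add_mul_pow_eq_of_shiftedPower hh (0 : R)
  simpa [ht] using this

theorem eval_one_shiftedPower [IsDomain R] (ht : t ≠ 0) (hζ : (t + 1) ^ l = 1)
    (hh : C (t ^ l) * h = (1 + C t * X) ^ l - 1) : h.eval 1 = 0 := by
  have := one_add_mul_pow_eq_of_shiftedPower hh (1 : R)
  simpa [ht, add_comm 1 t, hζ] using this

/-- A self-map of a finite set taking the same value at `0` and `1` is not surjective. Any `c` whose
residue is missed by `h` works. -/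
theorem exists_isUnit_forall_pow_ne [NeZero l] [IsDomain R] [IsLocalRing R]
    [Finite (ResidueField R)] [IsIntegrallyClosed R] (K : Type*) [Field K] [Algebra R K]
    [IsFractionRing R K] (ht : t ≠ 0) (hζ : (t + 1) ^ l = 1)
    (hh : C (t ^ l) * h = (1 + C t * X) ^ l - 1) (hm : h.Monic) (hdeg : h.natDegree = l) :
    ∃ c : R, IsUnit (1 + t ^ l * c) ∧ ∀ y : K, y ^ l ≠ algebraMap R K (1 + t ^ l * c) := by
  have hl : l ≠ 0 := NeZero.ne l
  let ψ : ResidueField R → ResidueField R := fun x => aeval x h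
  have hψ : ∀ x : R, ψ (residue R x) = residue R (h.eval x) := fun x => by
    rw [← ResidueField.algebraMap_eq]
    simp only [ψ]
    rw [aeval_algebraMap_apply, coe_aeval_eq_eval]
  have hni : ¬ Function.Injective ψ := by
    intro hi
    have : residue R 0 = residue R 1 := hi (by
      rw [hψ, hψ, eval_zero_shiftedPower ht hh, eval_one_shiftedPower ht hζ hh])
    simp at this
  have hns : ¬ Function.Surjective ψ := fun hs => hni (Finite.injective_iff_surjective.2 hs)
  obtain ⟨c', hc'⟩ := not_forall.1 hns
  obtain ⟨c, rfl⟩ := residue_surjective c'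
  refine ⟨c, ?_, fun y hy => hc' ?_⟩
  · by_contra hn
    have h0 : residue R (1 + t ^ l * c) = 0 := (residue_eq_zero_iff _).2 hn
    have ht0 : residue R t ≠ 0 := by
      intro h1
      simp [h1, hl] at h0
    apply hc'
    -- If `1 + t ^ l c` vanished in the residue field, the point where `1 + t x = 0` would be sent
    -- by `h` to the residue of `c`.
    refine ⟨-(residue R t)⁻¹, ?_⟩
    have := one_add_mul_pow_eq_of_shiftedPower hh (-(residue R t)⁻¹)
    rw [ResidueField.algebraMap_eq, mul_neg, mul_inv_cancel₀ ht0, add_neg_cancel, zero_pow hl]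
      at this
    rw [map_add, map_one, map_mul, map_pow, this, add_right_inj] at h0
    exact (mul_left_cancel₀ (pow_ne_zero _ ht0) h0).symm
  · have htK : algebraMap R K t ≠ 0 := by simpa using ht
    have hr := aeval_shiftedPower_of_pow_eq hh htK hy
    obtain ⟨x, hx⟩ := IsIntegrallyClosed.isIntegral_iff.1
      (⟨_, hm.sub_C (hdeg ▸ hl) c, hr⟩ : IsIntegral R ((y - 1) / algebraMap R K t))
    rw [← hx, aeval_algebraMap_apply, coe_aeval_eq_eval] at hr
    have hr' : (h - C c).eval x = 0 :=
      IsFractionRing.injective R K (hr.trans (map_zero _).symm)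
    rw [eval_sub, eval_C, sub_eq_zero] at hr'
    exact ⟨residue R x, by rw [hψ, hr']⟩

end ShiftedPower

/-! ### Adjoining an `l`-th root of `1 + t ^ l c` is unramified. -/

section Unramified

variable {R K L : Type*} [CommRing R] [IsDedekindDomain R] [Field K] [Field L]
  [Algebra R K] [IsFractionRing R K] [Algebra K L] [Algebra R L] [IsScalarTower R K L]
  [FiniteDimensional K L] [CharZero K]

/-- The derivative of the minimal polynomial at an integral generator lies in the different. If it
is a unit, the different is trivial and no prime ramifies. -/
theorem unramified_integralClosure_of_isUnit_aeval_derivative {x : integralClosure R L}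
    (hx : IntermediateField.adjoin K {(x : L)} = ⊤)
    (hu : IsUnit (aeval x (derivative (minpoly R x)))) :
    Algebra.Unramified R (integralClosure R L) := by
  have : IsDedekindDomain (integralClosure R L) := integralClosure.isDedekindDomain R K L
  have : IsFractionRing (integralClosure R L) L :=
    integralClosure.isFractionRing_of_finite_extension K L
  have : Module.Finite R (integralClosure R L) := IsIntegralClosure.finite R K L _
  have : Module.IsTorsionFree R L := .trans_faithfulSMul R K L
  have : CharZero (FractionRing R) :=
    charZero_of_injective_ringHom (f := ((FractionRing.algEquiv R K).symm : K →+* FractionRing R))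
      (FractionRing.algEquiv R K).symm.injective
  have hx' : Algebra.adjoin K {algebraMap (integralClosure R L) L x} = ⊤ := by
    rw [← IntermediateField.adjoin_simple_toSubalgebra_of_isAlgebraic
      (Algebra.IsAlgebraic.isAlgebraic _)]
    exact congrArg IntermediateField.toSubalgebra hx
  have hmem := aeval_derivative_mem_differentIdeal R K L x hx'
  have htop : differentIdeal R (integralClosure R L) = ⊤ := Ideal.eq_top_of_isUnit_mem _ hmem hu
  rw [Algebra.unramified_iff_forall]
  intro P
  rw [← not_dvd_differentIdeal_iff, htop]
  exact fun h => P.2.ne_top (top_le_iff.1 (Ideal.le_of_dvd h))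

/-- The generator to use is `x = (y - 1) / t`. Its minimal polynomial is `h - c`, by comparing
degrees, and the derivative there is a unit because `(1 + t x) ^ l = 1 + t ^ l c` is one. -/
theorem unramified_integralClosure_of_pow_eq {l : ℕ} [NeZero l] {t : R} (ht : t ≠ 0) {h : R[X]}
    {η : Rˣ} (hh : C (t ^ l) * h = (1 + C t * X) ^ l - 1) (hm : h.Monic) (hdeg : h.natDegree = l)
    (hd : derivative h = C (η : R) * (1 + C t * X) ^ (l - 1)) {c : R}
    (hu : IsUnit (1 + t ^ l * c)) {y : L} (hy : y ^ l = algebraMap R L (1 + t ^ l * c))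
    (htop : IntermediateField.adjoin K {y} = ⊤) (hrank : Module.finrank K L = l) :
    Algebra.Unramified R (integralClosure R L) := by
  have hl : l ≠ 0 := NeZero.ne l
  have htL : algebraMap R L t ≠ 0 := by
    rw [IsScalarTower.algebraMap_apply R K L]
    simpa using ht
  have hmc : (h - C c).Monic := hm.sub_C (hdeg ▸ hl) c
  have hr := aeval_shiftedPower_of_pow_eq hh htL hy
  have hint : IsIntegral R ((y - 1) / algebraMap R L t) := ⟨_, hmc, hr⟩
  let x : integralClosure R L := ⟨(y - 1) / algebraMap R L t, hint⟩
  have hyx : y = 1 + algebraMap R L t * x := by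
    simp only [x]
    rw [mul_div_cancel₀ _ htL, add_sub_cancel]
  have hxtop : IntermediateField.adjoin K {(x : L)} = ⊤ := by
    rw [eq_top_iff, ← htop, IntermediateField.adjoin_simple_le_iff, hyx]
    refine add_mem (one_mem _) (mul_mem ?_ (IntermediateField.mem_adjoin_simple_self K _))
    rw [IsScalarTower.algebraMap_apply R K L]
    exact IntermediateField.algebraMap_mem _ _
  have hxr : aeval x (h - C c) = 0 := by
    apply Subtype.val_injective
    rw [← Subalgebra.coe_val, ← aeval_algHom_apply]
    exact hr
  have hxint : IsIntegral R x := ⟨_, hmc, hxr⟩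
  have : Module.IsTorsionFree R L := .trans_faithfulSMul R K L
  have hmin : minpoly R (x : L) = h - C c := by
    refine (eq_of_monic_of_dvd_of_natDegree_le (minpoly.monic hint) hmc
      (minpoly.isIntegrallyClosed_dvd hint hr) ?_).symm
    rw [natDegree_sub_C, hdeg, ← hrank, ← (minpoly.monic hint).natDegree_map (algebraMap R K),
      ← minpoly.isIntegrallyClosed_eq_field_fractions' K hint,
      ← IntermediateField.adjoin.finrank (IsIntegral.of_finite K _), hxtop,
      IntermediateField.finrank_top']
  have hmin' : minpoly R x = h - C c := by
    rw [← hmin]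
    exact (minpoly.algebraMap_eq (A := R) (B := integralClosure R L) (B' := L)
      Subtype.val_injective x).symm
  apply unramified_integralClosure_of_isUnit_aeval_derivative (K := K) hxtop
  rw [hmin', derivative_sub, derivative_C, sub_zero, hd]
  simp only [map_mul, aeval_C, map_pow, map_add, map_one, aeval_X]
  refine (η.isUnit.map _).mul (IsUnit.pow _ ?_)
  rw [← isUnit_pow_iff hl]
  convert! hu.map (algebraMap R (integralClosure R L)) using 1
  apply Subtype.val_injective
  rw [hyx] at hy
  exact hy

end Unramified

/-! ### Residue fields of unramified extensions, and transfer of roots between them. -/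

section ResidueField

theorem finrank_residueField_of_unramified {R S : Type*} [CommRing R] [CommRing S] [IsLocalRing R]
    [IsLocalRing S] [Algebra R S] [IsLocalHom (algebraMap R S)] [Module.Finite R S]
    [Module.Free R S] [Algebra.FormallyUnramified R S] :
    Module.finrank (ResidueField R) (ResidueField S) = Module.finrank R S := by
  have h : (maximalIdeal R).map (algebraMap R S) = maximalIdeal S :=
    Algebra.FormallyUnramified.map_maximalIdeal
  let e : (S ⧸ (maximalIdeal R).map (algebraMap R S)) ≃+* ResidueField S :=
    Ideal.quotEquivOfEq h
  let _ : Module (R ⧸ maximalIdeal R) (ResidueField S) :=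
    inferInstanceAs (Module (ResidueField R) (ResidueField S))
  refine (LinearEquiv.finrank_eq (R := R ⧸ maximalIdeal R)
    (M := S ⧸ (maximalIdeal R).map (algebraMap R S)) (N := ResidueField S)
    { e with map_smul' := fun r x => ?_ }).symm.trans IsLocalRing.finrank_quotient_map
  obtain ⟨r, rfl⟩ := residue_surjective r
  obtain ⟨x, rfl⟩ := Ideal.Quotient.mk_surjective x
  rfl

/-- The residue fields of `S` and `T` are extensions of one finite field of the same degree, hence
isomorphic over it. The isomorphism carries the reduction of `x` to an approximate root in `T`,
where Hensel's lemma applies. -/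
theorem exists_pow_eq_of_unramified {R S T : Type*} [CommRing R] [IsDomain R] [CommRing S]
    [CommRing T] [IsLocalRing R]
    [IsLocalRing S] [HenselianLocalRing T] [Algebra R S] [Algebra R T]
    [IsLocalHom (algebraMap R S)] [IsLocalHom (algebraMap R T)]
    [Module.Finite R S] [Module.Free R S] [Module.Finite R T] [Module.Free R T]
    [Algebra.FormallyUnramified R S] [Algebra.FormallyUnramified R T] [Finite (ResidueField R)]
    (hrank : Module.finrank R S = Module.finrank R T)
    {l : ℕ} [NeZero l] {t : R} {h : R[X]}
    {η : Rˣ} (hh : C (t ^ l) * h = (1 + C t * X) ^ l - 1) (hm : h.Monic) (hdeg : h.natDegree = l)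
    (hd : derivative h = C (η : R) * (1 + C t * X) ^ (l - 1)) {c : R}
    (hu : IsUnit (1 + t ^ l * c)) {x : S} (hx : aeval x (h - C c) = 0) :
    ∃ y : T, y ^ l = algebraMap R T (1 + t ^ l * c) := by
  obtain ⟨p, hp⟩ := CharP.exists (ResidueField R)
  have : Fact p.Prime := ⟨(CharP.char_is_prime_or_zero (ResidueField R) p).resolve_right
    (CharP.char_ne_zero_of_finite (ResidueField R) p)⟩
  have hS := finrank_residueField_of_unramified (R := R) (S := S)
  have hT := finrank_residueField_of_unramified (R := R) (S := T)
  have : NeZero (Module.finrank R S) := ⟨Module.finrank_pos.ne'⟩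
  let e : ResidueField S ≃ₐ[ResidueField R] ResidueField T :=
    (FiniteField.algEquivExtension (ResidueField R) p (Module.finrank R S) (ResidueField S) hS).trans
      (FiniteField.algEquivExtension (ResidueField R) p (Module.finrank R S) (ResidueField T)
        (hT.trans hrank.symm)).symm
  obtain ⟨x₀, hx₀⟩ := residue_surjective (e (residue S x))
  refine exists_pow_eq_of_aeval_shiftedPower_mem hh hm hdeg hd hu (x₀ := x₀) ?_
  rw [← residue_eq_zero_iff, ← ResidueField.algebraMap_eq, ← aeval_algebraMap_apply,
    ResidueField.algebraMap_eq, hx₀]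
  have h1 : aeval (residue S x) (h - C c) = 0 := by
    rw [← ResidueField.algebraMap_eq, aeval_algebraMap_apply, hx, map_zero]
  have h2 := congrArg (e.restrictScalars R) h1
  rwa [← aeval_algHom_apply, map_zero] at h2

end ResidueField

namespace LocalKummer

/-! ### Kummer theory for cyclic extensions of prime degree `l`. -/

section Kummer

variable {l : ℕ} [hl : Fact l.Prime] {K : Type*} [Field K]

omit hl in
theorem powerClass_ofMul_eq_zero_iff {x : Kˣ} :
    powerClass l (Additive.ofMul x) = 0 ↔ ∃ y : Kˣ, y ^ l = x :=
  QuotientGroup.eq_one_iff x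

omit hl in
theorem powerClass_surjective : Function.Surjective (powerClass l : Additive Kˣ →+ _) :=
  QuotientGroup.mk'_surjective (powMonoidHom l : Kˣ →* Kˣ).range

theorem powerClass_mem_span_singleton {x a : Kˣ} :
    powerClass l (Additive.ofMul x) ∈
        Submodule.span (ZMod l) {powerClass l (Additive.ofMul a)} ↔
      ∃ (n : ℕ) (b : Kˣ), x = a ^ n * b ^ l := by
  have key : ∀ n : ℕ, (n : ZMod l) • powerClass l (Additive.ofMul a) =
      powerClass l (Additive.ofMul x) ↔ ∃ b : Kˣ, x = a ^ n * b ^ l := by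
    intro n
    rw [Nat.cast_smul_eq_nsmul, ← map_nsmul, eq_comm, ← sub_eq_zero, ← map_sub,
      ← ofMul_pow, ← ofMul_div, powerClass_ofMul_eq_zero_iff]
    refine exists_congr fun b => ?_
    rw [eq_div_iff_mul_eq', mul_comm, eq_comm]
  rw [Submodule.mem_span_singleton]
  constructor
  · rintro ⟨c, hc⟩
    have : NeZero l := ⟨hl.out.ne_zero⟩
    rw [← ZMod.natCast_zmod_val c] at hc
    exact ⟨_, (key _).1 hc⟩
  · rintro ⟨n, h⟩
    exact ⟨n, (key n).2 h⟩

variable {Ω : Type*} [Field Ω] [Algebra K Ω] {ζ : K}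

theorem exists_eq_pow_mul_of_pow_eq_pow (hζ : IsPrimitiveRoot ζ l) {y z : Ω}
    (h : y ^ l = z ^ l) : ∃ i, y = algebraMap K Ω ζ ^ i * z := by
  have hζ' := hζ.map_of_injective (algebraMap K Ω).injective
  by_cases hz : z = 0
  · subst hz
    rw [zero_pow hl.out.ne_zero] at h
    exact ⟨0, by simpa using eq_zero_of_pow_eq_zero h⟩
  have : (y / z) ^ l = 1 := by rw [div_pow, h, div_self (pow_ne_zero _ hz)]
  obtain ⟨i, -, hi⟩ := hζ'.eq_pow_of_pow_eq_one this
  exact ⟨i, by rw [hi, div_mul_cancel₀ _ hz]⟩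

theorem adjoinRoots_span_singleton (hζ : IsPrimitiveRoot ζ l) {a : Kˣ} {y : Ω}
    (hy : y ^ l = algebraMap K Ω a) :
    adjoinRoots l Ω (Submodule.span (ZMod l) {powerClass l (Additive.ofMul a)}) =
      IntermediateField.adjoin K {y} := by
  apply le_antisymm
  · rw [adjoinRoots, IntermediateField.adjoin_le_iff]
    rintro z ⟨x, hx, hz⟩
    obtain ⟨n, b, rfl⟩ := powerClass_mem_span_singleton.1 hx
    have : z ^ l = (y ^ n * algebraMap K Ω b) ^ l := by
      rw [hz, mul_pow, pow_right_comm, hy]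
      simp
    obtain ⟨i, rfl⟩ := exists_eq_pow_mul_of_pow_eq_pow hζ this
    exact mul_mem (pow_mem (IntermediateField.algebraMap_mem _ _) _)
      (mul_mem (pow_mem (IntermediateField.mem_adjoin_simple_self K _) _)
        (IntermediateField.algebraMap_mem _ _))
  · rw [IntermediateField.adjoin_simple_le_iff]
    exact IntermediateField.subset_adjoin _ _ ⟨a, Submodule.mem_span_singleton_self _, hy⟩

theorem finrank_adjoin_root {a : K} (ha : ∀ b : K, b ^ l ≠ a) {y : Ω}
    (hy : y ^ l = algebraMap K Ω a) :
    Module.finrank K (IntermediateField.adjoin K {y}) = l := by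
  have hm : (X ^ l - C a).Monic := monic_X_pow_sub_C a hl.out.ne_zero
  have hr : aeval y (X ^ l - C a) = 0 := by simp [hy]
  rw [IntermediateField.adjoin.finrank ⟨_, hm, hr⟩,
    ← minpoly.eq_of_irreducible_of_monic (X_pow_sub_C_irreducible_of_prime hl.out ha) hr hm,
    natDegree_X_pow_sub_C]

theorem finiteDimensional_adjoin_root {a : K} (ha : ∀ b : K, b ^ l ≠ a) {y : Ω}
    (hy : y ^ l = algebraMap K Ω a) :
    FiniteDimensional K (IntermediateField.adjoin K {y}) :=
  FiniteDimensional.of_finrank_pos (by rw [finrank_adjoin_root ha hy]; exact hl.out.pos)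

theorem adjoin_simple_gen_eq_top (y : Ω) :
    IntermediateField.adjoin K {IntermediateField.AdjoinSimple.gen K y} = ⊤ := by
  apply IntermediateField.lift_injective
  rw [IntermediateField.lift_adjoin_simple, IntermediateField.lift_top,
    IntermediateField.AdjoinSimple.coe_gen]

theorem isSplittingField_adjoin_root (hζ : IsPrimitiveRoot ζ l) {a : K} (ha : ∀ b : K, b ^ l ≠ a)
    {y : Ω} (hy : y ^ l = algebraMap K Ω a) :
    IsSplittingField K (IntermediateField.adjoin K {y}) (X ^ l - C a) := by
  have hr := finrank_adjoin_root ha hy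
  have := finiteDimensional_adjoin_root ha hy
  have h := isSplittingField_X_pow_sub_C_of_root_adjoin_eq_top (K := K)
    (L := IntermediateField.adjoin K {y}) (a := a) (α := IntermediateField.AdjoinSimple.gen K y)
    ⟨ζ, by rw [hr]; exact (mem_primitiveRoots hl.out.pos).2 hζ⟩
    (by rw [hr]; exact Subtype.val_injective hy) (adjoin_simple_gen_eq_top y)
  rwa [hr] at h

theorem isGalois_adjoin_root (hζ : IsPrimitiveRoot ζ l) {a : K} (ha : ∀ b : K, b ^ l ≠ a)
    {y : Ω} (hy : y ^ l = algebraMap K Ω a) : IsGalois K (IntermediateField.adjoin K {y}) := by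
  have := isSplittingField_adjoin_root hζ ha hy
  exact isGalois_of_isSplittingField_X_pow_sub_C
    ⟨ζ, (mem_primitiveRoots hl.out.pos).2 hζ⟩ (X_pow_sub_C_irreducible_of_prime hl.out ha) _

theorem nonempty_aut_adjoin_root_mulEquiv (hζ : IsPrimitiveRoot ζ l) {a : K}
    (ha : ∀ b : K, b ^ l ≠ a) {y : Ω} (hy : y ^ l = algebraMap K Ω a) :
    Nonempty ((IntermediateField.adjoin K {y} ≃ₐ[K] IntermediateField.adjoin K {y}) ≃*
      Multiplicative (ZMod l)) := by
  have := isSplittingField_adjoin_root hζ ha hy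
  have : NeZero l := ⟨hl.out.ne_zero⟩
  exact ⟨autEquivZmod (X_pow_sub_C_irreducible_of_prime hl.out ha) _ hζ⟩

/-- A generator `σ` of the Galois group multiplies `y` by a primitive `l`-th root of unity, and `z`
by a power of it. Hence `z / y ^ n` is fixed for a suitable `n` and lies in `K`. -/
theorem exists_eq_pow_mul_pow_of_mem_adjoin (hζ : IsPrimitiveRoot ζ l) {a b : K}
    (ha : ∀ c : K, c ^ l ≠ a) (ha0 : a ≠ 0) {y z : Ω} (hy : y ^ l = algebraMap K Ω a)
    (hz : z ^ l = algebraMap K Ω b) (hzy : z ∈ IntermediateField.adjoin K {y}) :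
    ∃ (n : ℕ) (c : K), b = a ^ n * c ^ l := by
  set L := IntermediateField.adjoin K {y} with hL
  have := finiteDimensional_adjoin_root ha hy
  have := isGalois_adjoin_root hζ ha hy
  have hcard : Nat.card (L ≃ₐ[K] L) = l := by
    rw [IsGalois.card_aut_eq_finrank, finrank_adjoin_root ha hy]
  have : Nontrivial (L ≃ₐ[K] L) := by
    rw [← Finite.one_lt_card_iff_nontrivial, hcard]
    exact hl.out.one_lt
  obtain ⟨σ, hσ⟩ := exists_ne (1 : L ≃ₐ[K] L)
  let y' : L := IntermediateField.AdjoinSimple.gen K y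
  let z' : L := ⟨z, hzy⟩
  have hy' : y' ^ l = algebraMap K L a := Subtype.val_injective hy
  have hz' : z' ^ l = algebraMap K L b := Subtype.val_injective hz
  have hy0 : y' ≠ 0 := by
    intro h
    rw [h, zero_pow hl.out.ne_zero] at hy'
    exact ha0 ((map_eq_zero _).1 hy'.symm)
  obtain ⟨i, hi⟩ : ∃ i, σ y' = algebraMap K L ζ ^ i * y' :=
    exists_eq_pow_mul_of_pow_eq_pow hζ (by rw [← map_pow, hy', AlgEquiv.commutes])
  have hi1 : ζ ^ i ≠ 1 := by
    intro h
    apply hσ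
    rw [← map_pow, h, map_one, one_mul] at hi
    have h1 : (σ : L →ₐ[K] L) = AlgHom.id K L :=
      IntermediateField.algHom_ext_of_eq_adjoin K hL (by rintro _ rfl; exact hi)
    exact AlgEquiv.ext fun w => DFunLike.congr_fun h1 w
  have hζi : IsPrimitiveRoot (ζ ^ i) l := by
    refine hζ.pow_of_coprime i ((Nat.Prime.coprime_iff_not_dvd hl.out).2 fun h => ?_).symm
    exact hi1 ((hζ.pow_eq_one_iff_dvd i).2 h)
  obtain ⟨n, hn⟩ : ∃ n, σ z' = algebraMap K L (ζ ^ i) ^ n * z' :=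
    exists_eq_pow_mul_of_pow_eq_pow hζi (by rw [← map_pow, hz', AlgEquiv.commutes])
  rw [← map_pow] at hi
  have hζ0 : algebraMap K L (ζ ^ i) ≠ 0 := by
    simpa using hζi.ne_zero hl.out.ne_zero
  have hfix : σ (z' / y' ^ n) = z' / y' ^ n := by
    rw [map_div₀, map_pow, hn, hi, mul_pow, mul_div_mul_left _ _ (pow_ne_zero _ hζ0)]
  have hbot : z' / y' ^ n ∈ (⊥ : IntermediateField K L) := by
    rw [IsGalois.mem_bot_iff_fixed]
    intro τ
    -- The group has prime order, so the nontrivial `σ` generates it and being fixed by `σ` is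
    -- enough.
    have : Fact (Nat.card (L ≃ₐ[K] L)).Prime := ⟨hcard.symm ▸ hl.out⟩
    obtain ⟨k, rfl⟩ := Subgroup.mem_zpowers_iff.1 (mem_zpowers_of_prime_card rfl hσ (g' := τ))
    have h1 : σ ∈ MulAction.stabilizer (L ≃ₐ[K] L) (z' / y' ^ n) := hfix
    exact (Subgroup.zpow_mem _ h1 k : σ ^ k ∈ MulAction.stabilizer (L ≃ₐ[K] L) (z' / y' ^ n))
  obtain ⟨c, hc⟩ := IntermediateField.mem_bot.1 hbot
  refine ⟨n, c, (algebraMap K L).injective ?_⟩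
  rw [map_mul, map_pow, map_pow, hc, ← hy', ← hz', div_pow, pow_right_comm,
    mul_div_cancel₀ _ (pow_ne_zero _ (pow_ne_zero _ hy0))]

end Kummer

/-! ### The ring of integers, its ramification index and its unit filtration. -/

section RingOfIntegers

theorem charZero_of_algebra_padic (p : ℕ) [Fact p.Prime] (K : Type*) [Field K] [Algebra ℚ_[p] K] :
    CharZero K :=
  charZero_of_injective_ringHom (algebraMap ℚ_[p] K).injective

variable (p : ℕ) [hp : Fact p.Prime] (K : Type*) [Field K] [Algebra ℚ_[p] K] [Algebra ℤ_[p] K]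
  [IsScalarTower ℤ_[p] ℚ_[p] K] [FiniteDimensional ℚ_[p] K]

instance : IsFractionRing (ringOfIntegers p K) K :=
  integralClosure.isFractionRing_of_finite_extension ℚ_[p] K

instance : IsDedekindDomain (ringOfIntegers p K) :=
  integralClosure.isDedekindDomain ℤ_[p] ℚ_[p] K

instance : Module.Finite ℤ_[p] (ringOfIntegers p K) :=
  IsIntegralClosure.finite ℤ_[p] ℚ_[p] K _

instance : FaithfulSMul ℤ_[p] (ringOfIntegers p K) := by
  rw [faithfulSMul_iff_algebraMap_injective]
  refine Function.Injective.of_comp (f := algebraMap (ringOfIntegers p K) K) ?_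
  rw [← RingHom.coe_comp, ← IsScalarTower.algebraMap_eq, IsScalarTower.algebraMap_eq ℤ_[p] ℚ_[p] K]
  exact (algebraMap ℚ_[p] K).injective.comp (IsFractionRing.injective _ _)

instance : Module.Free ℤ_[p] (ringOfIntegers p K) :=
  have : Module.IsTorsionFree ℤ_[p] (ringOfIntegers p K) :=
    Module.isTorsionFree_iff_algebraMap_injective.2 (FaithfulSMul.algebraMap_injective _ _)
  Module.free_of_finite_type_torsion_free'

instance : Finite (ResidueField (ringOfIntegers p K)) :=
  ResidueField.finite_of_finite (R := ℤ_[p]) (Finite.of_equiv _ PadicInt.residueField.symm.toEquiv)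

theorem maxIdeal_ne_bot : maxIdeal p K ≠ ⊥ := by
  intro h
  have h1 : (algebraMap ℤ_[p] (ringOfIntegers p K) p) ∈ maxIdeal p K := by
    rw [mem_maximalIdeal, mem_nonunits_iff, isUnit_map_iff]
    exact PadicInt.p_nonunit
  rw [h, Ideal.mem_bot, map_natCast] at h1
  have := charZero_of_algebra_padic p K
  exact hp.out.ne_zero (Nat.cast_injective (h1.trans Nat.cast_zero.symm))

instance : IsDiscreteValuationRing (ringOfIntegers p K) :=
  have h : IsDiscreteValuationRing (ringOfIntegers p K) ↔ IsDedekindDomain (ringOfIntegers p K) :=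
    (IsDiscreteValuationRing.TFAE (ringOfIntegers p K)
      fun h => maxIdeal_ne_bot p K (isField_iff_maximalIdeal_eq.1 h)).out 0 2
  h.2 inferInstance

theorem exists_span_singleton_eq_maxIdeal_pow {t : ringOfIntegers p K} (ht : t ≠ 0) :
    ∃ m, Ideal.span {t} = maxIdeal p K ^ m :=
  exists_maximalIdeal_pow_eq_of_principal _
    (IsPrincipalIdealRing.principal (maxIdeal p K)) _ (by simpa using ht)

omit [Algebra ℚ_[p] K] [IsScalarTower ℤ_[p] ℚ_[p] K] [FiniteDimensional ℚ_[p] K] in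
theorem map_maximalIdeal_padicInt : (maximalIdeal ℤ_[p]).map
    (algebraMap ℤ_[p] (ringOfIntegers p K)) = Ideal.span {(p : ringOfIntegers p K)} := by
  rw [PadicInt.maximalIdeal_eq_span_p, Ideal.map_span, Set.image_singleton, map_natCast]

theorem ramificationIndex_eq {n : ℕ}
    (h : Ideal.span {(p : ringOfIntegers p K)} = maxIdeal p K ^ n) :
    ramificationIndex p K = n := by
  apply Ideal.ramificationIdx'_spec
  · rw [map_maximalIdeal_padicInt, h]
  · rw [map_maximalIdeal_padicInt, h]
    exact (Ideal.pow_succ_lt_pow (maxIdeal_ne_bot p K) n).not_ge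

variable {K} in
-- If `l = p` and `(ζ - 1) = 𝔭 ^ m`, the relation `(ζ - 1) ^ (p - 1) ~ p` gives `e = m (p - 1)`, so
-- `e₁ = m`. If `l ≠ p`, then `l` and hence `ζ - 1` are units, and both ideals are the whole ring.
theorem sub_one_dvd_ramificationIndex_and_maxIdeal_pow_eq {l : ℕ} [hl : Fact l.Prime] {ζ : ringOfIntegers p K}
    (hζ : IsPrimitiveRoot ζ l) :
    (l = p → (p - 1) ∣ ramificationIndex p K) ∧
      maxIdeal p K ^ (p * e₁ p l K) = Ideal.span {(ζ - 1) ^ l} := by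
  have ht : ζ - 1 ≠ 0 := sub_ne_zero.2 (hζ.ne_one hl.out.one_lt)
  have has := hζ.associated_sub_one_pow_natCast
  by_cases hlp : l = p
  · obtain ⟨m, hm⟩ := exists_span_singleton_eq_maxIdeal_pow p K ht
    have he : ramificationIndex p K = m * (p - 1) := by
      apply ramificationIndex_eq
      have h1 : l - 1 = p - 1 := by rw [hlp]
      have h2 : (l : ringOfIntegers p K) = p := congrArg _ hlp
      rw [h1, h2] at has
      rw [pow_mul, ← hm, Ideal.span_singleton_pow, Ideal.span_singleton_eq_span_singleton]
      exact has.symm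
    have hp1 : 0 < p - 1 := Nat.sub_pos_of_lt hp.out.one_lt
    refine ⟨fun _ => ⟨m, by rw [he, mul_comm]⟩, ?_⟩
    rw [e₁, if_pos hlp, he, Nat.mul_div_cancel _ hp1, mul_comm, pow_mul, ← hm,
      Ideal.span_singleton_pow, hlp]
  · refine ⟨fun h => absurd h hlp, ?_⟩
    have hlu : IsUnit (l : ringOfIntegers p K) := by
      rw [← map_natCast (algebraMap ℤ_[p] (ringOfIntegers p K))]
      refine IsUnit.map _ ?_
      rw [PadicInt.isUnit_iff, PadicInt.norm_natCast_eq_one_iff]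
      exact (Nat.coprime_primes hp.out hl.out).2 (Ne.symm hlp)
    have htu : IsUnit (ζ - 1) :=
      (isUnit_pow_iff (Nat.sub_pos_of_lt hl.out.one_lt).ne').1 (has.isUnit_iff.2 hlu)
    rw [e₁, if_neg hlp, mul_zero, pow_zero, Ideal.one_eq_top,
      Ideal.span_singleton_eq_top.2 (htu.pow l)]

variable {p K} in
theorem mem_unitFiltration {n : ℕ} {x : Kˣ} : x ∈ unitFiltration p K n ↔
    ∃ v : ringOfIntegers p K, IsUnit v ∧ v - 1 ∈ maxIdeal p K ^ n ∧ (v : K) = x := by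
  rw [unitFiltration, Subgroup.mem_map]
  have key : ∀ v : (ringOfIntegers p K)ˣ,
      v ∈ (Units.map (Ideal.Quotient.mk (maxIdeal p K ^ n)).toMonoidHom).ker ↔
        (v : ringOfIntegers p K) - 1 ∈ maxIdeal p K ^ n := by
    intro v
    rw [MonoidHom.mem_ker, Units.ext_iff, ← Ideal.Quotient.mk_eq_mk_iff_sub_mem, map_one]
    rfl
  constructor
  · rintro ⟨v, hv, rfl⟩
    exact ⟨v, v.isUnit, (key v).1 hv, rfl⟩
  · rintro ⟨_, ⟨v, rfl⟩, hv, hx⟩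
    exact ⟨v, (key v).2 hv, Units.ext hx⟩

end RingOfIntegers

/-! ### Integral closures in finite extensions of `K`. -/

section Extension

variable (p : ℕ) [hp : Fact p.Prime] {K : Type*} [Field K] [Algebra ℚ_[p] K] [Algebra ℤ_[p] K]
  [IsScalarTower ℤ_[p] ℚ_[p] K] [FiniteDimensional ℚ_[p] K]
  (M : Type*) [Field M] [Algebra K M] [FiniteDimensional K M]

instance : Module.Finite (ringOfIntegers p K) (integralClosure (ringOfIntegers p K) M) :=
  have := charZero_of_algebra_padic p K
  IsIntegralClosure.finite (ringOfIntegers p K) K M _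

instance : Module.Free (ringOfIntegers p K) (integralClosure (ringOfIntegers p K) M) :=
  have := charZero_of_algebra_padic p K
  have : Module.IsTorsionFree (ringOfIntegers p K) M := .trans_faithfulSMul _ K M
  IsIntegralClosure.module_free (ringOfIntegers p K) K M _

instance : IsLocalHom (algebraMap (ringOfIntegers p K) (integralClosure (ringOfIntegers p K) M)) :=
  have : Algebra.IsIntegral (ringOfIntegers p K) (integralClosure (ringOfIntegers p K) M) :=
    inferInstance
  (algebraMap_isIntegral_iff.2 this).isLocalHom (Function.Injective.of_comp
    (f := algebraMap (integralClosure (ringOfIntegers p K) M) M)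
    ((algebraMap K M).injective.comp (IsFractionRing.injective (ringOfIntegers p K) K)))

theorem finrank_integralClosure_ringOfIntegers :
    Module.finrank (ringOfIntegers p K) (integralClosure (ringOfIntegers p K) M) =
      Module.finrank K M :=
  have := charZero_of_algebra_padic p K
  have : Module.IsTorsionFree (ringOfIntegers p K) M := .trans_faithfulSMul _ K M
  IsIntegralClosure.rank (ringOfIntegers p K) K M _

/-- By transitivity of integrality this ring is also the integral closure of `ℤ_[p]` in `M`, so it
is local, and it is finite free over the complete ring `ℤ_[p]`. -/
instance henselianLocalRing_integralClosure :
    HenselianLocalRing (integralClosure (ringOfIntegers p K) M) := by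
  let _ : Algebra ℚ_[p] M := Algebra.compHom M (algebraMap ℚ_[p] K)
  let _ : Algebra ℤ_[p] M := Algebra.compHom M (algebraMap ℤ_[p] K)
  have : IsScalarTower ℚ_[p] K M := .of_algebraMap_eq fun _ => rfl
  have : IsScalarTower ℤ_[p] K M := .of_algebraMap_eq fun _ => rfl
  have : IsScalarTower ℤ_[p] ℚ_[p] M := .of_algebraMap_eq fun x => by
    change algebraMap K M _ = algebraMap K M _
    rw [IsScalarTower.algebraMap_apply ℤ_[p] ℚ_[p] K]
  have : FiniteDimensional ℚ_[p] M := .trans ℚ_[p] K M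
  have : IsScalarTower ℤ_[p] (ringOfIntegers p K) M := .of_algebraMap_eq fun _ => rfl
  have h : (integralClosure (ringOfIntegers p K) M).toSubring =
      (ringOfIntegers p M).toSubring := by
    ext x
    exact ⟨fun hx => isIntegral_trans (R := ℤ_[p]) x hx, fun hx => IsIntegral.tower_top hx⟩
  have : IsLocalRing (ringOfIntegers p M).toSubring :=
    inferInstanceAs (IsLocalRing (ringOfIntegers p M))
  have : IsLocalRing (integralClosure (ringOfIntegers p K) M) :=
    (RingEquiv.subringCongr h.symm).isLocalRing
  have : Module.Finite ℤ_[p] (integralClosure (ringOfIntegers p K) M) :=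
    .trans (ringOfIntegers p K) _
  have : Module.Free ℤ_[p] (integralClosure (ringOfIntegers p K) M) :=
    .trans (S := ringOfIntegers p K)
  exact .of_finite_free ℤ_[p] _

end Extension

/-! ### Unramified cyclic extensions of degree `l` and the deepest step of the filtration. -/

variable {p l : ℕ} [hp : Fact p.Prime] [hl : Fact l.Prime] {K : Type*} [Field K] [Algebra ℚ_[p] K]
  [Algebra ℤ_[p] K] [IsScalarTower ℤ_[p] ℚ_[p] K] [FiniteDimensional ℚ_[p] K]
  {Ω : Type*} [Field Ω] [Algebra K Ω]

omit [Algebra ℚ_[p] K] [IsScalarTower ℤ_[p] ℚ_[p] K] [FiniteDimensional ℚ_[p] K] hl in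
theorem exists_isPrimitiveRoot_ringOfIntegers [NeZero l] (hζ : ∃ ζ : Kˣ, orderOf ζ = l) :
    ∃ ζ : ringOfIntegers p K, IsPrimitiveRoot ζ l := by
  obtain ⟨ζ, hζ⟩ := hζ
  have h1 : IsPrimitiveRoot (ζ : K) l :=
    IsPrimitiveRoot.coe_units_iff.2 (hζ ▸ IsPrimitiveRoot.orderOf ζ)
  refine ⟨⟨ζ, IsIntegral.of_pow (NeZero.pos l) (h1.pow_eq_one ▸ isIntegral_one)⟩, ?_⟩
  exact IsPrimitiveRoot.of_map_of_injective
    (f := algebraMap (ringOfIntegers p K) K) h1 Subtype.val_injective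

theorem isUnramifiedCyclicExtension_adjoin {ζ : ringOfIntegers p K} (hζ : IsPrimitiveRoot ζ l)
    {c : ringOfIntegers p K} (hu : IsUnit (1 + (ζ - 1) ^ l * c))
    (hne : ∀ b : K, b ^ l ≠ (1 + (ζ - 1) ^ l * c : ringOfIntegers p K)) {y : Ω}
    (hy : y ^ l = algebraMap K Ω (1 + (ζ - 1) ^ l * c : ringOfIntegers p K)) :
    IsUnramifiedCyclicExtension p l K (IntermediateField.adjoin K {y}) := by
  have hζK : IsPrimitiveRoot (ζ : K) l :=
    hζ.map_of_injective (IsFractionRing.injective (ringOfIntegers p K) K)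
  have := charZero_of_algebra_padic p K
  have := finiteDimensional_adjoin_root hne hy
  refine ⟨this, isGalois_adjoin_root hζK hne hy, nonempty_aut_adjoin_root_mulEquiv hζK hne hy, ?_⟩
  obtain ⟨η, h, hh, hm, hdeg, hd⟩ := hζ.exists_shiftedPower
  have : NeZero l := ⟨hl.out.ne_zero⟩
  refine unramified_integralClosure_of_pow_eq (K := K) (sub_ne_zero.2 (hζ.ne_one hl.out.one_lt))
    hh hm hdeg hd hu (y := IntermediateField.AdjoinSimple.gen K y) (Subtype.val_injective hy)
    (adjoin_simple_gen_eq_top y) (finrank_adjoin_root hne hy)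

omit hl [Algebra ℚ_[p] K] [IsScalarTower ℤ_[p] ℚ_[p] K] [FiniteDimensional ℚ_[p] K] in
theorem IsUnramifiedCyclicExtension.finrank_eq {M : Type*} [Field M] [Algebra K M]
    (hM : IsUnramifiedCyclicExtension p l K M) : Module.finrank K M = l := by
  have := hM.finiteDimensional
  have := hM.isGalois
  obtain ⟨e⟩ := hM.galoisGroup
  rw [← IsGalois.card_aut_eq_finrank, Nat.card_congr (e.toEquiv.trans Multiplicative.toAdd),
    Nat.card_zmod]

/-- The root of `h - c` in `K(y)` transfers to an `l`-th root of `1 + t ^ l c` in `M`, where `t = ζ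
- 1`. It differs from `y` by a power of `ζ`, so `K(y) ⊆ M`, and the degrees agree. -/
theorem IsUnramifiedCyclicExtension.eq_adjoin {ζ : ringOfIntegers p K} (hζ : IsPrimitiveRoot ζ l)
    {c : ringOfIntegers p K} (hu : IsUnit (1 + (ζ - 1) ^ l * c))
    (hne : ∀ b : K, b ^ l ≠ (1 + (ζ - 1) ^ l * c : ringOfIntegers p K)) {y : Ω}
    (hy : y ^ l = algebraMap K Ω (1 + (ζ - 1) ^ l * c : ringOfIntegers p K))
    {M : IntermediateField K Ω} (hM : IsUnramifiedCyclicExtension p l K M) :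
    M = IntermediateField.adjoin K {y} := by
  have hζK : IsPrimitiveRoot (ζ : K) l :=
    hζ.map_of_injective (IsFractionRing.injective (ringOfIntegers p K) K)
  have hN := isUnramifiedCyclicExtension_adjoin hζ hu hne hy
  obtain ⟨η, h, hh, hm, hdeg, hd⟩ := hζ.exists_shiftedPower
  have : NeZero l := ⟨hl.out.ne_zero⟩
  set N := IntermediateField.adjoin K {y} with hNdef
  have := hM.finiteDimensional
  have := hN.finiteDimensional
  have := hM.unramified.formallyUnramified
  have := hN.unramified.formallyUnramified
  have ht : ζ - 1 ≠ 0 := sub_ne_zero.2 (hζ.ne_one hl.out.one_lt)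
  have htN : algebraMap (ringOfIntegers p K) N (ζ - 1) ≠ 0 := by
    rw [IsScalarTower.algebraMap_apply _ K N]
    exact (_root_.map_ne_zero _).2 ((map_ne_zero_iff _ (IsFractionRing.injective _ K)).2 ht)
  have hr := aeval_shiftedPower_of_pow_eq hh htN
    (y := IntermediateField.AdjoinSimple.gen K y) (Subtype.val_injective hy)
  let x : integralClosure (ringOfIntegers p K) N :=
    ⟨_, _, hm.sub_C (hdeg ▸ hl.out.ne_zero) c, hr⟩
  have hx : aeval x (h - C c) = 0 := by
    apply Subtype.val_injective
    rw [← Subalgebra.coe_val, ← aeval_algHom_apply]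
    exact hr
  obtain ⟨z, hz⟩ := exists_pow_eq_of_unramified
    (T := integralClosure (ringOfIntegers p K) M)
    (by rw [finrank_integralClosure_ringOfIntegers, finrank_integralClosure_ringOfIntegers,
      hM.finrank_eq, hN.finrank_eq]) hh hm hdeg hd hu hx
  have hz' : ((z : M) : Ω) ^ l =
      algebraMap K Ω (1 + (ζ - 1) ^ l * c : ringOfIntegers p K) :=
    congrArg (fun w : integralClosure (ringOfIntegers p K) M => ((w : M) : Ω)) hz
  obtain ⟨i, hi⟩ := exists_eq_pow_mul_of_pow_eq_pow hζK (hy.trans hz'.symm)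
  have hle : N ≤ M := by
    rw [hNdef, IntermediateField.adjoin_simple_le_iff, hi]
    exact mul_mem (pow_mem (IntermediateField.algebraMap_mem _ _) _) (z : M).2
  exact (IntermediateField.eq_of_le_of_finrank_eq hle
    (by rw [hM.finrank_eq, hN.finrank_eq])).symm

omit hl in
theorem mem_filtrationBar {n : ℕ} {v : PowerClasses l K} : v ∈ filtrationBar p l K n ↔
    ∃ x ∈ unitFiltration p K n, powerClass l (Additive.ofMul x) = v :=
  Iff.rfl

theorem mem_unitFiltration_iff_of_pow_eq_span {n : ℕ} {s : ringOfIntegers p K}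
    (hn : maxIdeal p K ^ n = Ideal.span {s}) {x : Kˣ} : x ∈ unitFiltration p K n ↔
      ∃ c : ringOfIntegers p K, IsUnit (1 + s * c) ∧ (1 + s * c : ringOfIntegers p K) = (x : K) := by
  simp_rw [mem_unitFiltration, hn, Ideal.mem_span_singleton]
  constructor
  · rintro ⟨v, hv, ⟨c, hc⟩, hx⟩
    obtain rfl : v = 1 + s * c := by rw [← hc]; ring
    exact ⟨c, hv, hx⟩
  · rintro ⟨c, hc, hx⟩
    exact ⟨_, hc, ⟨c, by ring⟩, hx⟩

theorem forall_pow_ne_iff_powerClass_ne_zero {x : Kˣ} :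
    (∀ b : K, b ^ l ≠ x) ↔ powerClass l (Additive.ofMul x) ≠ 0 := by
  rw [Ne, powerClass_ofMul_eq_zero_iff, not_exists]
  constructor
  · intro h b hb
    exact h b (by rw [← hb, Units.val_pow_eq_pow_val])
  · intro h b hb
    have hb0 : b ≠ 0 := by
      rintro rfl
      rw [zero_pow hl.out.ne_zero] at hb
      exact x.ne_zero hb.symm
    exact h (Units.mk0 b hb0) (Units.ext hb)

/-- Beyond `p e₁` the unit is `1 + (ζ - 1) ^ l c` with `c ∈ 𝔭`, so `0` is an approximate root of `h
- c`. -/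
theorem filtrationBar_eq_bot {ζ : ringOfIntegers p K} (hζ : IsPrimitiveRoot ζ l) {n : ℕ}
    (hn : p * e₁ p l K < n) : filtrationBar p l K n = ⊥ := by
  rw [eq_bot_iff]
  intro v hv
  obtain ⟨x, hx, rfl⟩ := mem_filtrationBar.1 hv
  obtain ⟨w, hw, hwn, hwx⟩ := mem_unitFiltration.1 hx
  have ht : ζ - 1 ≠ 0 := sub_ne_zero.2 (hζ.ne_one hl.out.one_lt)
  have hmem : w - 1 ∈ Ideal.span {(ζ - 1) ^ l} * maxIdeal p K := by
    rw [← (sub_one_dvd_ramificationIndex_and_maxIdeal_pow_eq p hζ).2, ← pow_succ]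
    exact Ideal.pow_le_pow_right hn hwn
  obtain ⟨c, hc, hcw⟩ := Ideal.mem_span_singleton_mul.1 hmem
  obtain rfl : w = 1 + (ζ - 1) ^ l * c := by rw [hcw]; ring
  obtain ⟨η, h, hh, hm, hdeg, hd⟩ := hζ.exists_shiftedPower
  have : NeZero l := ⟨hl.out.ne_zero⟩
  have : HenselianLocalRing (ringOfIntegers p K) := .of_finite_free ℤ_[p] _
  obtain ⟨b, hb⟩ := exists_pow_eq_of_aeval_shiftedPower_mem hh hm hdeg hd hw
    (x₀ := (0 : ringOfIntegers p K)) (by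
      rw [map_sub, aeval_C, coe_aeval_eq_eval, eval_zero_shiftedPower ht hh, zero_sub]
      exact neg_mem hc)
  rw [Submodule.mem_bot]
  by_contra hne
  refine forall_pow_ne_iff_powerClass_ne_zero.2 hne (b : K) ?_
  rw [← hwx]
  exact congrArg Subtype.val hb

variable (Ω) in
theorem exists_filtrationBar_eq_span [IsAlgClosed Ω] {ζ : ringOfIntegers p K}
    (hζ : IsPrimitiveRoot ζ l) :
    ∃ (c : ringOfIntegers p K) (a : Kˣ), IsUnit (1 + (ζ - 1) ^ l * c) ∧
      (1 + (ζ - 1) ^ l * c : ringOfIntegers p K) = (a : K) ∧ (∀ b : K, b ^ l ≠ a) ∧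
      filtrationBar p l K (p * e₁ p l K) =
        Submodule.span (ZMod l) {powerClass l (Additive.ofMul a)} := by
  have hζK : IsPrimitiveRoot (ζ : K) l :=
    hζ.map_of_injective (IsFractionRing.injective (ringOfIntegers p K) K)
  have ht : ζ - 1 ≠ 0 := sub_ne_zero.2 (hζ.ne_one hl.out.one_lt)
  obtain ⟨η, h, hh, hm, hdeg, hd⟩ := hζ.exists_shiftedPower
  have : NeZero l := ⟨hl.out.ne_zero⟩
  obtain ⟨c, hc, hne⟩ := exists_isUnit_forall_pow_ne K ht (by simp [hζ.pow_eq_one]) hh hm hdeg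
  have hU := fun x : Kˣ => mem_unitFiltration_iff_of_pow_eq_span (x := x)
    (sub_one_dvd_ramificationIndex_and_maxIdeal_pow_eq p hζ).2
  let a : Kˣ := Units.map (algebraMap (ringOfIntegers p K) K).toMonoidHom hc.unit
  have ha : (1 + (ζ - 1) ^ l * c : ringOfIntegers p K) = (a : K) := rfl
  refine ⟨c, a, hc, ha, hne, le_antisymm ?_ ?_⟩
  · intro v hv
    obtain ⟨x, hx, rfl⟩ := mem_filtrationBar.1 hv
    by_cases hx0 : powerClass l (Additive.ofMul x) = 0
    · rw [hx0]
      exact zero_mem _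
    have hxne := forall_pow_ne_iff_powerClass_ne_zero.2 hx0
    obtain ⟨c', hc', hcx⟩ := (hU x).1 hx
    obtain ⟨y, hy⟩ := IsAlgClosed.exists_pow_nat_eq (algebraMap K Ω a) hl.out.pos
    obtain ⟨z, hz⟩ := IsAlgClosed.exists_pow_nat_eq (algebraMap K Ω x) hl.out.pos
    -- A second nontrivial class also gives an unramified extension of degree `l`, so its field is
    -- `K(y)`, and Kummer theory places the class on the line of `a`.
    have hM := isUnramifiedCyclicExtension_adjoin hζ hc' (by rwa [hcx]) (by rwa [hcx])
    have heq := hM.eq_adjoin hζ hc hne hy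
    obtain ⟨n, b, hb⟩ := exists_eq_pow_mul_pow_of_mem_adjoin hζK hne a.ne_zero hy hz
      (heq ▸ IntermediateField.mem_adjoin_simple_self K z)
    have hb0 : b ≠ 0 := by
      rintro rfl
      rw [zero_pow hl.out.ne_zero, mul_zero] at hb
      exact x.ne_zero hb
    exact powerClass_mem_span_singleton.2 ⟨n, Units.mk0 b hb0, Units.ext hb⟩
  · rw [Submodule.span_le, Set.singleton_subset_iff]
    exact mem_filtrationBar.2 ⟨a, (hU a).2 ⟨c, hc, ha⟩, rfl⟩

end LocalKummer

end

/-! ### The main theorem. -/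

theorem proposition16 (p l : ℕ) [Fact p.Prime] [Fact l.Prime]
    (K : Type*) [Field K] [Algebra ℚ_[p] K] [Algebra ℤ_[p] K] [IsScalarTower ℤ_[p] ℚ_[p] K]
    [FiniteDimensional ℚ_[p] K]
    (Ω : Type*) [Field Ω] [Algebra K Ω] [IsAlgClosure K Ω]
    (hζ : ∃ ζ : Kˣ, orderOf ζ = l) :
    -- the quotient defining `e₁` is an integer
    (l = p → (p - 1) ∣ LocalKummer.ramificationIndex p K) ∧
    -- `Ū_{p e₁}` is an `𝔽_l`-line, and it is the deepest nontrivial step of the filtration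
    Module.finrank (ZMod l) (LocalKummer.filtrationBar p l K (p * LocalKummer.e₁ p l K)) = 1 ∧
    (∀ n : ℕ, p * LocalKummer.e₁ p l K < n → LocalKummer.filtrationBar p l K n = ⊥) ∧
    -- adjoining the `l`-th roots of `Ū_{p e₁}` gives the one and only unramified
    -- `(ℤ/lℤ)`-extension of `K` in `Ω`
    (∀ M : IntermediateField K Ω, LocalKummer.IsUnramifiedCyclicExtension p l K M ↔
      M = LocalKummer.adjoinRoots l Ω
        (LocalKummer.filtrationBar p l K (p * LocalKummer.e₁ p l K))) ∧
    -- and `Ū_{p e₁}` is the only line with this property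
    (∀ D : Submodule (ZMod l) (LocalKummer.PowerClasses l K), Module.finrank (ZMod l) D = 1 →
      (LocalKummer.IsUnramifiedCyclicExtension p l K (LocalKummer.adjoinRoots l Ω D) ↔
        D = LocalKummer.filtrationBar p l K (p * LocalKummer.e₁ p l K))) := by
  have : NeZero l := ⟨Nat.Prime.ne_zero Fact.out⟩
  obtain ⟨ζ, hζ⟩ := LocalKummer.exists_isPrimitiveRoot_ringOfIntegers (p := p) hζ
  have hζK : IsPrimitiveRoot (ζ : K) l :=
    hζ.map_of_injective (IsFractionRing.injective (LocalKummer.ringOfIntegers p K) K)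
  have := IsAlgClosure.isAlgClosed K (K := Ω)
  obtain ⟨c, a, hc, hca, hne, hspan⟩ := LocalKummer.exists_filtrationBar_eq_span Ω hζ
  obtain ⟨y, hy⟩ := IsAlgClosed.exists_pow_nat_eq (algebraMap K Ω a) (NeZero.pos l)
  have hM : ∀ M : IntermediateField K Ω, LocalKummer.IsUnramifiedCyclicExtension p l K M ↔
      M = LocalKummer.adjoinRoots l Ω
        (LocalKummer.filtrationBar p l K (p * LocalKummer.e₁ p l K)) := by
    intro M
    rw [hspan, LocalKummer.adjoinRoots_span_singleton hζK hy]
    rw [← hca] at hne hy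
    constructor
    · exact fun h => h.eq_adjoin hζ hc hne hy
    · rintro rfl
      exact LocalKummer.isUnramifiedCyclicExtension_adjoin hζ hc hne hy
  have ha0 := LocalKummer.forall_pow_ne_iff_powerClass_ne_zero.1 hne
  have hrank : Module.finrank (ZMod l)
      (LocalKummer.filtrationBar p l K (p * LocalKummer.e₁ p l K)) = 1 := by
    rw [hspan]
    exact finrank_span_singleton ha0
  refine ⟨(LocalKummer.sub_one_dvd_ramificationIndex_and_maxIdeal_pow_eq p hζ).1, hrank,
    fun n hn => LocalKummer.filtrationBar_eq_bot hζ hn, hM, fun D hD => ?_⟩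
  rw [hM]
  refine ⟨fun h => ?_, fun h => by rw [h]⟩
  obtain ⟨⟨v, hvD⟩, hv0, -⟩ := finrank_eq_one_iff'.1 hD
  obtain ⟨b, rfl⟩ := LocalKummer.powerClass_surjective v
  obtain ⟨b, rfl⟩ := Additive.ofMul.surjective b
  have hb0 : LocalKummer.powerClass l (Additive.ofMul b) ≠ 0 := fun h0 => hv0 (Subtype.ext h0)
  have := Module.finite_of_finrank_eq_succ hD
  have := Module.finite_of_finrank_eq_succ hrank
  have hDspan : Submodule.span (ZMod l) {LocalKummer.powerClass l (Additive.ofMul b)} = D :=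
    Submodule.eq_of_le_of_finrank_eq (by simpa using hvD)
      (by rw [hD, finrank_span_singleton hb0])
  obtain ⟨z, hz⟩ := IsAlgClosed.exists_pow_nat_eq (algebraMap K Ω b) (NeZero.pos l)
  rw [← hDspan, hspan, LocalKummer.adjoinRoots_span_singleton hζK hy,
    LocalKummer.adjoinRoots_span_singleton hζK hz] at h
  -- Equality of the two fields puts an `l`-th root of `b` in `K(y)`, so the class of `b` is a
  -- multiple of that of `a`. Both spans being lines, they coincide.
  obtain ⟨n, d, hd⟩ := LocalKummer.exists_eq_pow_mul_pow_of_mem_adjoin hζK hne a.ne_zero hy hz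
    (h ▸ IntermediateField.mem_adjoin_simple_self K z)
  have hd0 : d ≠ 0 := by
    rintro rfl
    rw [zero_pow (NeZero.ne l), mul_zero] at hd
    exact b.ne_zero hd
  refine Submodule.eq_of_le_of_finrank_eq ?_ (by rw [hD, hrank])
  rw [← hDspan, hspan, Submodule.span_le, Set.singleton_subset_iff]
  exact LocalKummer.powerClass_mem_span_singleton.2 ⟨n, Units.mk0 d hd0, Units.ext hd⟩
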